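/- For $n\ge 1$ and $N=2n+1$, let $T_N$ be the $N\times N$ matrix with ones on the super- and subdiagonal and zeros elsewhere (the single-excitation Hamiltonian of the homogeneous XX spin chain with $N$ spins), let $|1\rangle,\dots,|N\rangle$ be the standard basis of $\mathbb{C}^N$, let $v_1,\dots,v_N$ be an orthonormal basis of eigenvectors of $T_N$, and put $$p_{\max}^{[1:N]}(i,j)=\Bigl|\sum_{k=1}^N\bigl|\langle i|v_k\rangle\langle v_k|j\rangle\bigr|\Bigr|^2 ,\qquad 1\le i,j\le N,$$ which does not depend on the choice of the $v_k$. For integers $i',j'$ (positions relative to the central spin $n+1$) with $|i'|,|j'|\le n$ put $p_{\max}^{[-n:n]}(i',j')=p_{\max}^{[1:N]}(i'+n+1,\,j'+n+1)$. The doubly-infinite chain is described by $$\sqrt{p_{\max}^{\leftrightarrow}(i',j')}=\lim_{n\to\infty}\sqrt{p_{\max}^{[-n:n]}(i',j')},\qquad d^{\leftrightarrow}(i',j')=-\log p_{\max}^{\leftrightarrow}(i',j'),\qquad i',j'\in\mathbb{Z}.$$ Then these limits exist for all $i',j'\in\mathbb{Z}$, and the diameter of the doubly-infinite chain is finite: $$\sup_{i',j'\in\mathbb{Z}}d^{\leftrightarrow}(i',j')=-2\log(2/\pi).$$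 The supremum is attained by the pairs consisting of the center and another spin: for every integer $j'\neq 0$, $$d^{\leftrightarrow}(0,j')=d^{\leftrightarrow}(j',0)=-2\log(2/\pi).$$ Moreover, $\sqrt{p_{\max}^{\leftrightarrow}(i',j')}\ge 8/\pi^2>2/\pi$ for all nonzero integers $i',j'$. -/

import Mathlib

open Filter Topology

noncomputable section

/-- The single-excitation Hamiltonian `H₁ = T_N` of the homogeneous XX chain with `N` spins:
ones on the super- and subdiagonal, zeros elsewhere. The spin called `i ∈ {1, …, N}` in the usual
numbering is `i - 1 : Fin N` here. -/
def xxHamiltonian (N : ℕ) : Matrix (Fin N) (Fin N) ℂ :=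
  Matrix.of fun i j => if (i : ℕ) + 1 = j ∨ (j : ℕ) + 1 = i then 1 else 0

theorem xxHamiltonian_isHermitian (N : ℕ) : (xxHamiltonian N).IsHermitian := by
  ext i j
  simp only [xxHamiltonian, Matrix.conjTranspose_apply, Matrix.of_apply]
  by_cases h : (i : ℕ) + 1 = j ∨ (j : ℕ) + 1 = i
  · rw [if_pos h, if_pos h.symm, star_one]
  · rw [if_neg h, if_neg (fun h' => h h'.symm), star_zero]

/-- The state `|i⟩`: the excitation is on spin `i`. -/
def siteState (N : ℕ) (i : Fin N) : EuclideanSpace ℂ (Fin N) :=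
  EuclideanSpace.single i 1

/-- An orthonormal basis `v_k` of eigenvectors of `H₁`. (All eigenvalues of `H₁` are simple, so
the `v_k` are determined up to phases and order, and `pmax` below does not depend on the choice.) -/
def xxEigenvector (N : ℕ) (k : Fin N) : EuclideanSpace ℂ (Fin N) :=
  (xxHamiltonian_isHermitian N).eigenvectorBasis k

/-- Maximum transfer probability (information transfer capacity) of the chain with `N` spins:
`p_max(i,j) = | ∑ₖ |⟨i|v_k⟩⟨v_k|j⟩| |²`. -/
def pmax (N : ℕ) (i j : Fin N) : ℝ :=
  |∑ k : Fin N, ‖inner ℂ (siteState N i) (xxEigenvector N k) *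
    inner ℂ (xxEigenvector N k) (siteState N j)‖| ^ 2

/-- `p_max` of the chain with `N = 2n+1` spins, with positions relative to the center:
`p_max^{[-n:n]}(i',j') = p_max^{[1:N]}(i'+(n+1), j'+(n+1))`.
The value is `0` if a position is outside the chain. -/
def pmaxCentered (n : ℕ) (i j : ℤ) : ℝ :=
  if h : |i| ≤ n ∧ |j| ≤ n then
    pmax (2 * n + 1)
      ⟨(i + n).toNat, by have := abs_le.mp h.1; omega⟩
      ⟨(j + n).toNat, by have := abs_le.mp h.2; omega⟩
  else 0

/-- The amplitude `√p_max^↔(i',j') = lim_{n → ∞} √p_max^{[-n:n]}(i',j')` of the doubly-infinite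
chain. -/
def amplitudeDoubly (i j : ℤ) : ℝ :=
  limUnder atTop fun n : ℕ => √(pmaxCentered n i j)

/-- `p_max^↔(i',j')`. -/
def pmaxDoubly (i j : ℤ) : ℝ := amplitudeDoubly i j ^ 2

/-- The ITC pre-metric `d^↔(i',j') = -log p_max^↔(i',j')`, with value `+∞` if
`p_max^↔(i',j') = 0`. -/
def itcDistDoubly (i j : ℤ) : EReal :=
  -ENNReal.log (ENNReal.ofReal (pmaxDoubly i j))

/-- The ITC diameter of the doubly-infinite chain. -/
def itcDiamDoubly : EReal := ⨆ i : ℤ, ⨆ j : ℤ, itcDistDoubly i j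

end

/-! The eigenvectors of `T_N` are sine vectors, and the eigenvalues are simple. For `N + 1 = 2(n+1)`
and a site at distance `i` from the center, the phase in the `k`-th eigenvector is `πk/2 +
πki/(2(n+1))`, so even `k` contribute `|sin|` and odd `k` contribute `|cos|`. The amplitude is thus
a sum of two Riemann sums with `n+1` cells, converging to `amplitudeIntegral i j`
(`tendsto_sqrt_pmaxCentered`).

If exactly one index is `0`, the integral is the mean of `|cos|`, namely `2/π`. If both are nonzero,
multiply out the Fourier series of `|sin|` and `|cos|` (`amplitudeIntegral_ge`): only the zeroth
coefficient is positive. The constant terms give `2 (2/π)^2 = 8/π^2`, terms with exactly one zero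
frequency integrate to `0`, and the others are nonnegative, being products of two negative
coefficients with nonnegative factors. -/

/-! ### Fourier series of `|sin|` and `|cos|`. -/

/-- The Fourier coefficients of `y ↦ |sin (π y)|`, a function of period one. -/
noncomputable def absSinCoeff (m : ℤ) : ℝ := 2 / (Real.pi * (1 - 4 * (m : ℝ) ^ 2))

theorem one_sub_four_mul_sq_ne_zero (m : ℤ) : (1 - 4 * (m : ℝ) ^ 2) ≠ 0 := by
  have h : (1 - 4 * m ^ 2 : ℤ) ≠ 0 := by omega
  exact_mod_cast h

theorem absSinCoeff_zero : absSinCoeff 0 = 2 / Real.pi := by simp [absSinCoeff]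

theorem absSinCoeff_neg {m : ℤ} (hm : m ≠ 0) : absSinCoeff m < 0 := by
  have h1 : (1 : ℝ) ≤ (m : ℝ) ^ 2 := by
    have : (1 : ℤ) ≤ m ^ 2 := by have := sq_pos_of_ne_zero hm; omega
    exact_mod_cast this
  exact div_neg_of_pos_of_neg two_pos (mul_neg_of_pos_of_neg Real.pi_pos (by linarith))

theorem summable_absSinCoeff : Summable absSinCoeff := by
  have h := Real.summable_one_div_int_pow (p := 2) |>.mpr one_lt_two
  refine Summable.of_norm_bounded_eventually h ?_
  -- At `m = 0` the bound `1 / m ^ 2` is `0` by convention, so that index is discarded.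
  have : ∀ᶠ m : ℤ in cofinite, m ≠ 0 := eventually_cofinite_ne 0
  filter_upwards [this] with m hm
  have h1 : (1 : ℝ) ≤ (m : ℝ) ^ 2 := by
    have : (1 : ℤ) ≤ m ^ 2 := by have := sq_pos_of_ne_zero hm; omega
    exact_mod_cast this
  rw [Real.norm_eq_abs, abs_of_neg (absSinCoeff_neg hm), absSinCoeff, ← div_neg]
  rw [div_le_div_iff₀ _ (by linarith)]
  · nlinarith [Real.pi_gt_three]
  · nlinarith [Real.pi_gt_three]

theorem summable_norm_absSinCoeff : Summable fun m => ‖absSinCoeff m‖ :=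
  summable_absSinCoeff.norm

theorem integral_exp_mul_sin (n : ℤ) :
    ∫ x in (0 : ℝ)..1, Complex.exp (-(2 * Real.pi * Complex.I * n) * x) * Complex.sin (Real.pi * x)
      = (absSinCoeff n : ℂ) := by
  have hpi : (Real.pi : ℂ) ≠ 0 := by exact_mod_cast Real.pi_ne_zero
  have hn : (1 - 4 * (n : ℂ) ^ 2) ≠ 0 := by exact_mod_cast one_sub_four_mul_sq_ne_zero n
  set c : ℂ := -(2 * Real.pi * Complex.I * n) with hc
  have hc2 : c ^ 2 + (Real.pi : ℂ) ^ 2 = (Real.pi : ℂ) ^ 2 * (1 - 4 * (n : ℂ) ^ 2) := by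
    rw [hc]; ring_nf; rw [Complex.I_sq]; ring
  have hne : c ^ 2 + (Real.pi : ℂ) ^ 2 ≠ 0 := by
    rw [hc2]; exact mul_ne_zero (pow_ne_zero _ hpi) hn
  -- Antiderivative from integrating by parts twice; its denominator is nonzero because `4n² ≠ 1`.
  have hd : ∀ x : ℝ, HasDerivAt (fun x : ℝ => Complex.exp (c * x) *
      (c * Complex.sin (Real.pi * x) - Real.pi * Complex.cos (Real.pi * x)) /
        (c ^ 2 + (Real.pi : ℂ) ^ 2))
      (Complex.exp (c * x) * Complex.sin (Real.pi * x)) x := by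
    intro x
    have h1 : HasDerivAt (fun x : ℂ => c * x) c (x : ℂ) := by
      simpa using (hasDerivAt_id (x : ℂ)).const_mul c
    have h2 : HasDerivAt (fun x : ℂ => (Real.pi : ℂ) * x) (Real.pi : ℂ) (x : ℂ) := by
      simpa using (hasDerivAt_id (x : ℂ)).const_mul (Real.pi : ℂ)
    have h3 := ((h1.cexp.mul ((h2.csin.const_mul c).sub
      (h2.ccos.const_mul (Real.pi : ℂ)))).div_const (c ^ 2 + (Real.pi : ℂ) ^ 2)).comp_ofReal
    refine h3.congr_deriv ?_
    rw [div_eq_iff hne]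
    simp only [Pi.sub_apply]
    ring
  rw [intervalIntegral.integral_eq_sub_of_hasDerivAt (fun x _ => hd x)
    (Continuous.intervalIntegrable (by fun_prop) _ _)]
  have he : Complex.exp c = 1 := by
    rw [Complex.exp_eq_one_iff]; exact ⟨-n, by rw [hc]; push_cast; ring⟩
  simp only [Complex.ofReal_one, mul_one, Complex.ofReal_zero, mul_zero, he, Complex.exp_zero,
    Complex.sin_pi, Complex.cos_pi, Complex.sin_zero, Complex.cos_zero, hc2, absSinCoeff]
  push_cast
  field_simp
  ring

theorem periodic_abs_sin_pi_mul :
    Function.Periodic (fun x : ℝ => ((|Real.sin (Real.pi * x)| : ℝ) : ℂ)) 1 := by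
  intro x
  simp [mul_add, Real.sin_add_pi]

/-- Summable Fourier coefficients of a continuous function give pointwise convergence; real parts
turn exponentials into cosines. -/
theorem hasSum_abs_sin (y : ℝ) :
    HasSum (fun m : ℤ => absSinCoeff m * Real.cos (2 * Real.pi * m * y))
      |Real.sin (Real.pi * y)| := by
  let f : C(AddCircle (1 : ℝ), ℂ) := ⟨periodic_abs_sin_pi_mul.lift, by
    refine continuous_coinduced_dom.mpr ?_
    change Continuous fun x : ℝ => ((|Real.sin (Real.pi * x)| : ℝ) : ℂ)
    fun_prop⟩
  have hf : ∀ x : ℝ, f x = ((|Real.sin (Real.pi * x)| : ℝ) : ℂ) := fun x => rfl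
  have hcoef : ∀ n, fourierCoeff f n = (absSinCoeff n : ℂ) := by
    intro n
    rw [fourierCoeff_eq_intervalIntegral _ _ 0, ← integral_exp_mul_sin]
    simp only [zero_add, div_one, one_smul]
    refine intervalIntegral.integral_congr fun x hx => ?_
    rw [Set.uIcc_of_le zero_le_one] at hx
    have h0 : 0 ≤ Real.sin (Real.pi * x) := Real.sin_nonneg_of_nonneg_of_le_pi
      (mul_nonneg Real.pi_pos.le hx.1) (by nlinarith [Real.pi_pos, hx.2])
    simp only [hf, fourier_coe_apply, abs_of_nonneg h0, smul_eq_mul]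
    push_cast
    congr 2
    ring
  have hs : Summable (fourierCoeff f) := by
    rw [funext hcoef]
    exact Complex.summable_ofReal.mpr summable_absSinCoeff
  have h := has_pointwise_sum_fourier_series_of_summable hs (y : AddCircle (1 : ℝ))
  have h2 := Complex.hasSum_re h
  rw [hf, Complex.ofReal_re] at h2
  convert h2 using 2 with m
  rw [hcoef, fourier_coe_apply, smul_eq_mul, Complex.re_ofReal_mul]
  congr 1
  rw [show (2 * Real.pi * Complex.I * m * y / (1 : ℝ) : ℂ)
    = ((2 * Real.pi * m * y : ℝ) : ℂ) * Complex.I by push_cast; ring]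
  rw [Complex.exp_ofReal_mul_I_re]

theorem hasSum_abs_cos (y : ℝ) :
    HasSum (fun m : ℤ => absSinCoeff m * ((-1) ^ m * Real.cos (2 * Real.pi * m * y)))
      |Real.cos (Real.pi * y)| := by
  have h := hasSum_abs_sin (y + 1 / 2)
  rw [show Real.pi * (y + 1 / 2) = Real.pi * y + Real.pi / 2 by ring,
    Real.sin_add_pi_div_two] at h
  convert h using 3 with m
  rw [show 2 * Real.pi * m * (y + 1 / 2) = 2 * Real.pi * m * y + m * Real.pi by ring,
    Real.cos_add_int_mul_pi]

/-! ### The limiting integral and its lower bound. -/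

theorem integral_cos_two_pi_int_mul {A : ℤ} (hA : A ≠ 0) :
    ∫ x in (0 : ℝ)..1, Real.cos (2 * Real.pi * A * x) = 0 := by
  have hA' : 2 * Real.pi * A ≠ 0 := by
    have : (A : ℝ) ≠ 0 := by exact_mod_cast hA
    positivity
  rw [intervalIntegral.integral_comp_mul_left _ hA']
  simp [Real.sin_eq_zero_iff]
  right
  exact ⟨2 * A, by push_cast; ring⟩

/-- By product-to-sum this is half a sum of two means of cosines, each `0` or `1`. -/
theorem integral_cos_mul_cos_nonneg (A B : ℤ) :
    0 ≤ ∫ x in (0 : ℝ)..1, Real.cos (2 * Real.pi * A * x) * Real.cos (2 * Real.pi * B * x) := by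
  have key : ∀ C : ℤ, 0 ≤ ∫ x in (0 : ℝ)..1, Real.cos (2 * Real.pi * C * x) := by
    intro C
    by_cases hC : C = 0
    · simp [hC]
    · rw [integral_cos_two_pi_int_mul hC]
  have h : ∀ x : ℝ, Real.cos (2 * Real.pi * A * x) * Real.cos (2 * Real.pi * B * x) =
      (1 / 2) * (Real.cos (2 * Real.pi * (A - B : ℤ) * x)
        + Real.cos (2 * Real.pi * (A + B : ℤ) * x)) := by
    intro x
    have := Real.two_mul_cos_mul_cos (2 * Real.pi * A * x) (2 * Real.pi * B * x)
    push_cast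
    rw [show 2 * Real.pi * (A - B) * x = 2 * Real.pi * A * x - 2 * Real.pi * B * x by ring,
      show 2 * Real.pi * (A + B) * x = 2 * Real.pi * A * x + 2 * Real.pi * B * x by ring]
    linarith
  simp_rw [h]
  rw [intervalIntegral.integral_const_mul, intervalIntegral.integral_add
    (Continuous.intervalIntegrable (by fun_prop) _ _)
    (Continuous.intervalIntegrable (by fun_prop) _ _)]
  have := key (A - B)
  have := key (A + B)
  positivity

/-- The amplitude of the doubly-infinite chain, as a mean over one period. -/
noncomputable def amplitudeIntegral (i j : ℤ) : ℝ :=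
  ∫ x in (0 : ℝ)..1, (|Real.sin (Real.pi * (i * x))| * |Real.sin (Real.pi * (j * x))| +
    |Real.cos (Real.pi * (i * x))| * |Real.cos (Real.pi * (j * x))|)

theorem hasSum_intervalIntegral_of_norm_le {ι : Type*} [Countable ι] {F : ι → ℝ → ℝ} {f : ℝ → ℝ}
    {b : ι → ℝ} (hF : ∀ k, Continuous (F k)) (hb : Summable b) (hle : ∀ k x, ‖F k x‖ ≤ b k)
    (hsum : ∀ x, HasSum (fun k => F k x) (f x)) :
    HasSum (fun k => ∫ x in (0 : ℝ)..1, F k x) (∫ x in (0 : ℝ)..1, f x) :=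
  intervalIntegral.hasSum_integral_of_dominated_convergence (fun k _ => b k)
    (fun k => (hF k).aestronglyMeasurable) (fun k => MeasureTheory.ae_of_all _ fun x _ => hle k x)
    (MeasureTheory.ae_of_all _ fun _ _ => hb) intervalIntegrable_const (MeasureTheory.ae_of_all _ fun x _ => hsum x)

theorem abs_neg_one_zpow_mul_cos_le (m : ℤ) (x : ℝ) : |(-1) ^ m * Real.cos x| ≤ 1 := by
  rw [abs_mul, abs_neg_one_zpow, one_mul]
  exact Real.abs_cos_le_one x

theorem integral_abs_cos {j : ℤ} (hj : j ≠ 0) :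
    ∫ x in (0 : ℝ)..1, |Real.cos (Real.pi * (j * x))| = 2 / Real.pi := by
  have h := hasSum_intervalIntegral_of_norm_le
    (F := fun (m : ℤ) x => absSinCoeff m * ((-1) ^ m * Real.cos (2 * Real.pi * m * (j * x))))
    (fun m => by fun_prop) summable_norm_absSinCoeff
    (fun m x => by
      rw [norm_mul]
      exact mul_le_of_le_one_right (norm_nonneg _) (abs_neg_one_zpow_mul_cos_le _ _))
    (fun x => hasSum_abs_cos (j * x))
  refine h.unique ?_
  convert hasSum_single (0 : ℤ) ?_ using 1
  · simp [absSinCoeff_zero]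
  · intro m hm
    have := integral_cos_two_pi_int_mul (mul_ne_zero hm hj)
    push_cast at this
    simp only [intervalIntegral.integral_const_mul]
    simp only [mul_assoc] at this ⊢
    rw [this]
    simp

theorem amplitudeIntegral_zero_left {j : ℤ} (hj : j ≠ 0) :
    amplitudeIntegral 0 j = 2 / Real.pi := by
  rw [← integral_abs_cos hj]
  simp [amplitudeIntegral]

theorem amplitudeIntegral_comm (i j : ℤ) : amplitudeIntegral i j = amplitudeIntegral j i := by
  simp only [amplitudeIntegral, mul_comm |Real.sin (Real.pi * (i * _))|,
    mul_comm |Real.cos (Real.pi * (i * _))|]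

theorem amplitudeIntegral_zero_zero : amplitudeIntegral 0 0 = 1 := by
  simp [amplitudeIntegral]

theorem amplitudeIntegral_ge {i j : ℤ} (hi : i ≠ 0) (hj : j ≠ 0) :
    8 / Real.pi ^ 2 ≤ amplitudeIntegral i j := by
  have hS := summable_norm_absSinCoeff.mul_norm summable_norm_absSinCoeff
  simp only [norm_mul] at hS
  have hle1 : ∀ (m : ℤ) (y : ℝ), ‖absSinCoeff m * Real.cos y‖ ≤ ‖absSinCoeff m‖ := fun m y => by
    rw [norm_mul]
    exact mul_le_of_le_one_right (norm_nonneg _) (Real.abs_cos_le_one _)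
  have hle2 : ∀ (m : ℤ) (y : ℝ), ‖absSinCoeff m * ((-1) ^ m * Real.cos y)‖ ≤ ‖absSinCoeff m‖ :=
    fun m y => by
      rw [norm_mul]
      exact mul_le_of_le_one_right (norm_nonneg _) (abs_neg_one_zpow_mul_cos_le _ _)
  have hprod : ∀ x : ℝ, HasSum (fun p : ℤ × ℤ =>
      absSinCoeff p.1 * absSinCoeff p.2 * (1 + (-1) ^ p.1 * (-1) ^ p.2) *
        (Real.cos (2 * Real.pi * (p.1 * i : ℤ) * x) * Real.cos (2 * Real.pi * (p.2 * j : ℤ) * x)))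
      (|Real.sin (Real.pi * (i * x))| * |Real.sin (Real.pi * (j * x))| +
        |Real.cos (Real.pi * (i * x))| * |Real.cos (Real.pi * (j * x))|) := by
    intro x
    have hs := (hasSum_abs_sin (i * x)).mul (hasSum_abs_sin (j * x))
      (hS.of_norm_bounded fun p => by
        rw [norm_mul]
        exact mul_le_mul (hle1 _ _) (hle1 _ _) (norm_nonneg _) (norm_nonneg _))
    have hc := (hasSum_abs_cos (i * x)).mul (hasSum_abs_cos (j * x))
      (hS.of_norm_bounded fun p => by
        rw [norm_mul]
        exact mul_le_mul (hle2 _ _) (hle2 _ _) (norm_nonneg _) (norm_nonneg _))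
    refine HasSum.congr_fun (hs.add hc) fun p => ?_
    push_cast
    rw [show 2 * Real.pi * (p.1 * i) * x = 2 * Real.pi * p.1 * (i * x) by ring,
      show 2 * Real.pi * (p.2 * j) * x = 2 * Real.pi * p.2 * (j * x) by ring]
    ring
  -- The parity factor, from adding the sine and cosine series, is `0` or `2`.
  have hnn : ∀ a b : ℤ, 0 ≤ (1 + (-1) ^ a * (-1) ^ b : ℝ) ∧ (1 + (-1) ^ a * (-1) ^ b : ℝ) ≤ 2 := by
    intro a b
    have h : |((-1) ^ a * (-1) ^ b : ℝ)| ≤ 1 := by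
      rw [abs_mul, abs_neg_one_zpow, abs_neg_one_zpow, mul_one]
    have := abs_le.mp h
    constructor <;> linarith
  have h := hasSum_intervalIntegral_of_norm_le (F := fun (p : ℤ × ℤ) x =>
      absSinCoeff p.1 * absSinCoeff p.2 * (1 + (-1) ^ p.1 * (-1) ^ p.2) *
        (Real.cos (2 * Real.pi * (p.1 * i : ℤ) * x) * Real.cos (2 * Real.pi * (p.2 * j : ℤ) * x)))
    (fun p => by fun_prop) (hS.mul_right 2)
    (fun p x => by
      rw [norm_mul, norm_mul, norm_mul, mul_assoc (‖absSinCoeff p.1‖ * ‖absSinCoeff p.2‖)]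
      refine mul_le_mul_of_nonneg_left ?_ (by positivity)
      rw [← mul_one (2 : ℝ)]
      refine mul_le_mul ?_ ?_ (norm_nonneg _) two_pos.le
      · rw [Real.norm_of_nonneg (hnn _ _).1]; exact (hnn _ _).2
      · rw [norm_mul]
        exact mul_le_one₀ (Real.abs_cos_le_one _) (norm_nonneg _) (Real.abs_cos_le_one _))
    hprod
  simp only [intervalIntegral.integral_const_mul] at h
  have h0 := le_hasSum h (0, 0) ?_
  · refine le_trans (le_of_eq ?_) h0
    simp [absSinCoeff_zero]
    field_simp
    norm_num
  · rintro ⟨a, b⟩ hab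
    dsimp only
    by_cases ha : a = 0
    · have hb : b ≠ 0 := fun hb => hab (by rw [ha, hb])
      have := integral_cos_two_pi_int_mul (mul_ne_zero hb hj)
      simp only [ha, zero_mul, Int.cast_zero, mul_zero, Real.cos_zero, one_mul, this, le_refl]
    by_cases hb : b = 0
    · have := integral_cos_two_pi_int_mul (mul_ne_zero ha hi)
      simp only [hb, zero_mul, Int.cast_zero, mul_zero, Real.cos_zero, mul_one, this, le_refl]
    · exact mul_nonneg (mul_nonneg (mul_nonneg_of_nonpos_of_nonpos (absSinCoeff_neg ha).le
        (absSinCoeff_neg hb).le) (hnn _ _).1) (integral_cos_mul_cos_nonneg _ _)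

/-! ### Riemann sums. -/

/-- Riemann sums with `N` cells and tags at relative position `s` in each cell. -/
theorem tendsto_riemannSum {f : ℝ → ℝ} (hf : Continuous f) {s : ℝ} (hs0 : 0 ≤ s) (hs1 : s ≤ 1) :
    Tendsto (fun N : ℕ => (1 / (N : ℝ)) * ∑ m ∈ Finset.range N, f ((m + s) / N)) atTop
      (𝓝 (∫ x in (0 : ℝ)..1, f x)) := by
  rw [Metric.tendsto_atTop]
  intro ε hε
  have huc := isCompact_Icc.uniformContinuousOn_of_continuous (s := Set.Icc (0 : ℝ) 1)
    hf.continuousOn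
  obtain ⟨δ, hδ, h⟩ := Metric.uniformContinuousOn_iff.mp huc (ε / 2) (half_pos hε)
  obtain ⟨N₀, hN₀⟩ := exists_nat_one_div_lt hδ
  refine ⟨N₀ + 1, fun N hN => ?_⟩
  have hNpos : (0 : ℝ) < N := by exact_mod_cast (by omega : 0 < N)
  have hNδ : 1 / (N : ℝ) < δ := by
    refine lt_of_le_of_lt ?_ hN₀
    exact one_div_le_one_div_of_le (by positivity) (by exact_mod_cast hN)
  have hsplit : ∫ x in (0 : ℝ)..1, f x =
      ∑ m ∈ Finset.range N, ∫ x in ((m : ℝ) / N)..((m + 1 : ℕ) : ℝ) / N, f x := by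
    rw [intervalIntegral.sum_integral_adjacent_intervals (a := fun k : ℕ => (k : ℝ) / N)
      (fun k _ => hf.intervalIntegrable _ _)]
    simp [hNpos.ne']
  rw [dist_eq_norm, hsplit, Finset.mul_sum, ← Finset.sum_sub_distrib]
  -- Tag and integration variable share a cell of width `1/N < δ`, so uniform continuity applies.
  have hterm : ∀ m ∈ Finset.range N, ‖1 / (N : ℝ) * f ((m + s) / N) -
      ∫ x in ((m : ℝ) / N)..((m + 1 : ℕ) : ℝ) / N, f x‖ ≤ ε / 2 * (1 / N) := by
    intro m hm
    have hmN : (m : ℝ) + 1 ≤ N := by exact_mod_cast Finset.mem_range.mp hm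
    have hlen : ((m + 1 : ℕ) : ℝ) / N - m / N = 1 / N := by push_cast; ring
    have hconst : 1 / (N : ℝ) * f ((m + s) / N) =
        ∫ _x in ((m : ℝ) / N)..((m + 1 : ℕ) : ℝ) / N, f ((m + s) / N) := by
      rw [intervalIntegral.integral_const, hlen, smul_eq_mul]
    rw [hconst, ← intervalIntegral.integral_sub intervalIntegrable_const
      (hf.intervalIntegrable _ _)]
    have hpos : (0 : ℝ) < 1 / N := by positivity
    refine (intervalIntegral.norm_integral_le_of_norm_le_const (C := ε / 2) ?_).trans
      (by rw [hlen, abs_of_pos hpos])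
    intro x hx
    rw [Set.uIoc_of_le (by linarith)] at hx
    have hm0 : (0 : ℝ) ≤ m := m.cast_nonneg
    have h1 : (m : ℝ) / N ≤ (m + s) / N := by gcongr; linarith
    have h2 : (m + s) / N ≤ ((m + 1 : ℕ) : ℝ) / N := by push_cast; gcongr
    have h3 : ((m + 1 : ℕ) : ℝ) / N ≤ 1 := by
      rw [div_le_one hNpos]; push_cast; exact hmN
    have h4 : (0 : ℝ) ≤ (m : ℝ) / N := by positivity
    rw [← dist_eq_norm]
    refine (h _ ⟨by linarith, by linarith⟩ _ ⟨by linarith [hx.1], by linarith [hx.2]⟩ ?_).le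
    rw [Real.dist_eq, abs_lt]
    constructor <;> linarith [hx.1, hx.2]
  calc _ ≤ ∑ _m ∈ Finset.range N, ε / 2 * (1 / (N : ℝ)) := norm_sum_le_of_le _ hterm
    _ = ε / 2 := by simp; field_simp
    _ < ε := half_lt_self hε

/-! ### Spectral decomposition of the finite chain. -/

section

open Matrix

/-- If a Hermitian matrix has `card n` distinct eigenvalues, every eigenvector basis consists of
multiples of the given eigenvectors `u l`. -/
theorem exists_equiv_eigenvectorBasis {n : Type*} [Fintype n] [DecidableEq n] {A : Matrix n n ℂ}
    (hA : A.IsHermitian) {u : n → EuclideanSpace ℂ n} {c : n → ℝ} (hc : Function.Injective c)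
    (hu : ∀ l, u l ≠ 0) (hAu : ∀ l, A *ᵥ (u l).ofLp = (c l : ℂ) • (u l).ofLp) :
    ∃ e : n ≃ n, ∀ l, ∃ z : ℂ, u l = z • hA.eigenvectorBasis (e l) := by
  set v := hA.eigenvectorBasis with hv
  -- Eigenvectors of a Hermitian matrix that are not orthogonal share their eigenvalue.
  have key : ∀ l k, inner ℂ (v k) (u l) ≠ 0 → hA.eigenvalues k = c l := by
    intro l k hne
    have h1 : star (v k).ofLp ⬝ᵥ (A *ᵥ (u l).ofLp)
        = (hA.eigenvalues k : ℂ) * (star (v k).ofLp ⬝ᵥ (u l).ofLp) := by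
      have h2 := hA.mulVec_eigenvectorBasis k
      rw [dotProduct_mulVec]
      nth_rewrite 1 [← hA.eq]
      rw [← star_mulVec, h2]
      simp [hv, star_smul, smul_dotProduct]
    rw [hAu, dotProduct_smul, smul_eq_mul] at h1
    have h3 : star (v k).ofLp ⬝ᵥ (u l).ofLp ≠ 0 := by
      rwa [EuclideanSpace.inner_eq_star_dotProduct, dotProduct_comm] at hne
    exact_mod_cast (mul_right_cancel₀ h3 h1).symm
  have hex : ∀ l, ∃ k, inner ℂ (v k) (u l) ≠ 0 := by
    intro l
    by_contra! h
    apply hu l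
    rw [← v.sum_repr' (u l)]
    simp [h]
  choose t ht using hex
  have hinj : Function.Injective t := fun a b hab =>
    hc ((key a _ (ht a)).symm.trans (hab ▸ key b _ (ht b)))
  have hbij : Function.Bijective t := Finite.injective_iff_bijective.mp hinj
  refine ⟨Equiv.ofBijective t hbij, fun l => ⟨inner ℂ (v (t l)) (u l), ?_⟩⟩
  conv_lhs => rw [← v.sum_repr' (u l)]
  refine Finset.sum_eq_single (t l) (fun k _ hk => ?_) (by simp)
  have : inner ℂ (v k) (u l) = 0 := by
    by_contra hne
    obtain ⟨b, rfl⟩ := hbij.2 k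
    exact hk (congrArg t (hc ((key b _ (ht b)).symm.trans (key l _ hne))))
  rw [this, zero_smul]

/-- The `l`-th (unnormalized) eigenvector of the homogeneous XX chain. -/
noncomputable def sineVector (N : ℕ) (l : Fin N) : EuclideanSpace ℂ (Fin N) :=
  WithLp.toLp 2 fun i => ((Real.sin (Real.pi * (l + 1) * (i + 1) / (N + 1)) : ℝ) : ℂ)

/-- Uses `sin((k+1)θ) + sin((k-1)θ) = 2 cos θ sin(kθ)`; the missing neighbours at the ends cost
nothing, as the sine vanishes at positions `0` and `N + 1`. -/
theorem xxHamiltonian_mulVec_sineVector (N : ℕ) (l : Fin N) :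
    xxHamiltonian N *ᵥ (sineVector N l).ofLp =
      ((2 * Real.cos (Real.pi * (l + 1) / (N + 1)) : ℝ) : ℂ) • (sineVector N l).ofLp := by
  set θ := Real.pi * (l + 1) / (N + 1) with hθ
  have hN : (N + 1 : ℝ) ≠ 0 := by positivity
  have hs : ∀ i : Fin N, (sineVector N l).ofLp i = ((Real.sin (θ * (i + 1)) : ℝ) : ℂ) := by
    intro i
    simp only [sineVector, hθ]
    congr 2
    ring
  have hlast : Real.sin (θ * (N + 1)) = 0 := by
    rw [hθ, div_mul_cancel₀ _ hN, mul_comm]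
    exact_mod_cast Real.sin_nat_mul_pi (l + 1)
  ext i
  simp only [Matrix.mulVec, dotProduct, Pi.smul_apply, smul_eq_mul, hs, xxHamiltonian,
    Matrix.of_apply, ite_mul, one_mul, zero_mul]
  have hsplit : ∀ j : Fin N, (if (i : ℕ) + 1 = j ∨ (j : ℕ) + 1 = i then
      ((Real.sin (θ * (j + 1)) : ℝ) : ℂ) else 0) =
      (((if (j : ℕ) = i + 1 then Real.sin (θ * (i + 2)) else 0) +
        (if (j : ℕ) + 1 = i then Real.sin (θ * i) else 0) : ℝ) : ℂ) := by
    intro j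
    by_cases h1 : (j : ℕ) = i + 1
    · have h2 : ¬ (j : ℕ) + 1 = i := by omega
      rw [if_pos (Or.inl h1.symm), if_pos h1, if_neg h2, add_zero, h1]
      push_cast
      ring_nf
    · by_cases h2 : (j : ℕ) + 1 = i
      · rw [if_pos (Or.inr h2), if_neg h1, if_pos h2, zero_add, ← h2]
        push_cast
        ring_nf
      · rw [if_neg (by omega), if_neg h1, if_neg h2]
        simp
  have hup : ∑ j : Fin N, (if (j : ℕ) = i + 1 then Real.sin (θ * (i + 2)) else 0)
      = Real.sin (θ * (i + 2)) := by
    by_cases h : (i : ℕ) + 1 < N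
    · rw [Finset.sum_eq_single ⟨i + 1, h⟩]
      · simp
      · intro b _ hb
        exact if_neg fun hb' => hb (Fin.ext hb')
      · simp
    · have hi : (N : ℝ) = i + 1 := by exact_mod_cast (by omega : N = i + 1)
      rw [show (i + 2 : ℝ) = N + 1 by rw [hi]; ring, hlast]
      simp
  have hdown : ∑ j : Fin N, (if (j : ℕ) + 1 = i then Real.sin (θ * i) else 0)
      = Real.sin (θ * i) := by
    by_cases h : (i : ℕ) = 0
    · simp [h]
    · rw [Finset.sum_eq_single ⟨i - 1, by omega⟩]
      · rw [if_pos]; simp; omega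
      · intro b _ hb
        rw [if_neg]
        intro hb'
        apply hb
        ext
        simp; omega
      · simp
  rw [Finset.sum_congr rfl fun j _ => hsplit j, ← Complex.ofReal_sum, Finset.sum_add_distrib,
    hup, hdown, ← Complex.ofReal_mul]
  congr 1
  rw [show θ * (i + 2) = θ * (i + 1) + θ by ring, show θ * i = θ * (i + 1) - θ by ring,
    Real.sin_add, Real.sin_sub]
  ring

theorem xxEigenvalue_injective (N : ℕ) :
    Function.Injective fun l : Fin N => 2 * Real.cos (Real.pi * (l + 1) / (N + 1)) := by
  intro a b hab
  have hN : (0 : ℝ) < N + 1 := by positivity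
  have hmem : ∀ l : Fin N, Real.pi * (l + 1) / (N + 1) ∈ Set.Icc 0 Real.pi := by
    intro l
    have hl : (l + 1 : ℝ) ≤ N := by exact_mod_cast l.2
    refine ⟨by positivity, ?_⟩
    rw [div_le_iff₀ hN]
    exact mul_le_mul_of_nonneg_left (by linarith) Real.pi_pos.le
  have h := Real.injOn_cos (hmem a) (hmem b) (mul_left_cancel₀ two_ne_zero hab)
  field_simp at h
  ext
  exact_mod_cast add_right_cancel h

/-- Real part of a full geometric sum of powers of a root of unity other than `1`. -/
theorem sum_range_cos_eq_zero {N k : ℕ} (hk : 0 < k) (hkN : k < N) :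
    ∑ m ∈ Finset.range N, Real.cos (2 * Real.pi * k * m / N) = 0 := by
  have hN : (N : ℂ) ≠ 0 := by exact_mod_cast (by omega : N ≠ 0)
  have hprim := Complex.isPrimitiveRoot_exp N (by omega)
  set w := Complex.exp (2 * Real.pi * Complex.I / N) with hw
  have hne : w ^ k ≠ 1 := hprim.pow_ne_one_of_pos_of_lt hk.ne' hkN
  have h := mul_geom_sum (w ^ k) N
  rw [← pow_mul, mul_comm k N, pow_mul, hprim.pow_eq_one, one_pow, sub_self] at h
  have h0 := (mul_eq_zero.mp h).resolve_left (sub_ne_zero.mpr hne)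
  have := congrArg Complex.re h0
  rw [Complex.re_sum, Complex.zero_re] at this
  rw [← this]
  refine Finset.sum_congr rfl fun m _ => ?_
  rw [← pow_mul, hw, ← Complex.exp_nat_mul, show ((k * m : ℕ) : ℂ) * (2 * Real.pi * Complex.I / N)
    = ((2 * Real.pi * k * m / N : ℝ) : ℂ) * Complex.I by push_cast; ring,
    Complex.exp_ofReal_mul_I_re]

theorem norm_sq_sineVector (N : ℕ) (l : Fin N) : ‖sineVector N l‖ ^ 2 = (N + 1) / 2 := by
  rw [EuclideanSpace.norm_sq_eq]
  have h1 : ∀ i : Fin N, ‖(sineVector N l).ofLp i‖ ^ 2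
      = Real.sin (Real.pi * (l + 1) * ((i + 1 : ℕ) : ℝ) / (N + 1)) ^ 2 := by
    intro i
    simp only [sineVector, Complex.norm_real, Real.norm_eq_abs, sq_abs]
    push_cast
    rfl
  rw [Finset.sum_congr rfl fun i _ => h1 i, Fin.sum_univ_eq_sum_range
    (fun i : ℕ => Real.sin (Real.pi * (l + 1) * ((i + 1 : ℕ) : ℝ) / (N + 1)) ^ 2)]
  -- Adding the vanishing term at position `0` makes the sum run over a full period `N + 1`.
  have h2 := Finset.sum_range_succ'
    (fun i : ℕ => Real.sin (Real.pi * (l + 1) * (i : ℝ) / (N + 1)) ^ 2) N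
  simp only [Nat.cast_zero, mul_zero, zero_div, Real.sin_zero, ne_eq, OfNat.ofNat_ne_zero,
    not_false_eq_true, zero_pow, add_zero] at h2
  rw [← h2]
  have h3 := sum_range_cos_eq_zero (N := N + 1) (k := l + 1) (by omega) (by omega)
  have h4 : ∀ i : ℕ, Real.sin (Real.pi * (l + 1) * (i : ℝ) / (N + 1)) ^ 2
      = 1 / 2 - Real.cos (2 * Real.pi * ((l + 1 : ℕ) : ℝ) * i / ((N + 1 : ℕ) : ℝ)) / 2 := by
    intro i
    rw [Real.sin_sq_eq_half_sub]
    push_cast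
    ring_nf
  rw [Finset.sum_congr rfl fun i _ => h4 i, Finset.sum_sub_distrib,
    ← Finset.sum_div (Finset.range (N + 1)) fun m : ℕ =>
      Real.cos (2 * Real.pi * ((l + 1 : ℕ) : ℝ) * m / ((N + 1 : ℕ) : ℝ)), h3]
  simp
  ring

/-- The eigenbasis is the sine basis up to order and scalars `z`; absolute values remove the phases
and `‖z‖ ^ 2 = (N + 1) / 2` gives the prefactor. -/
theorem sqrt_pmax_eq (N : ℕ) (i j : Fin N) :
    √(pmax N i j) = 2 / (N + 1) * ∑ l : Fin N,
      |Real.sin (Real.pi * (l + 1) * (i + 1) / (N + 1))| *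
        |Real.sin (Real.pi * (l + 1) * (j + 1) / (N + 1))| := by
  have hN : (0 : ℝ) < (N + 1) / 2 := by positivity
  have hne : ∀ l, sineVector N l ≠ 0 := by
    intro l h
    have := norm_sq_sineVector N l
    rw [h] at this
    simp at this
    linarith
  obtain ⟨e, he⟩ := exists_equiv_eigenvectorBasis (xxHamiltonian_isHermitian N)
    (xxEigenvalue_injective N) hne (xxHamiltonian_mulVec_sineVector N)
  rw [pmax, sq_abs, Real.sqrt_sq (Finset.sum_nonneg fun _ _ => norm_nonneg _), ← e.sum_comp,
    Finset.mul_sum]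
  refine Finset.sum_congr rfl fun l _ => ?_
  obtain ⟨z, hz⟩ := he l
  have hnorm : ‖z‖ ^ 2 = (N + 1) / 2 := by
    rw [← norm_sq_sineVector N l, hz, norm_smul, OrthonormalBasis.norm_eq_one, mul_one]
  have hcoord : ∀ i : Fin N, |Real.sin (Real.pi * (l + 1) * (i + 1) / (N + 1))|
      = ‖z‖ * ‖xxEigenvector N (e l) i‖ := by
    intro i
    have h := congrArg (fun w : EuclideanSpace ℂ (Fin N) => ‖w i‖) hz
    simp only [PiLp.smul_apply, smul_eq_mul, norm_mul] at h
    rw [xxEigenvector, ← h, sineVector, Complex.norm_real, Real.norm_eq_abs]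
  rw [hcoord, hcoord, norm_mul, siteState, siteState, EuclideanSpace.inner_single_left,
    EuclideanSpace.inner_single_right]
  simp only [map_one, one_mul, RCLike.norm_conj]
  rw [show 2 / ((N : ℝ) + 1) * (‖z‖ * ‖xxEigenvector N (e l) i‖ * (‖z‖ * ‖xxEigenvector N (e l) j‖))
    = 2 / ((N : ℝ) + 1) * ‖z‖ ^ 2 * (‖xxEigenvector N (e l) i‖ * ‖xxEigenvector N (e l) j‖) by ring,
    hnorm]
  field_simp

end

/-! ### Parity splitting and the infinite-chain limit. -/

theorem sum_range_two_mul {M : Type*} [AddCommMonoid M] (g : ℕ → M) (n : ℕ) :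
    ∑ k ∈ Finset.range (2 * n), g k =
      ∑ m ∈ Finset.range n, g (2 * m) + ∑ m ∈ Finset.range n, g (2 * m + 1) := by
  induction n with
  | zero => simp
  | succ n ih =>
    rw [Nat.mul_succ, Finset.sum_range_succ, Finset.sum_range_succ, ih, Finset.sum_range_succ,
      Finset.sum_range_succ, add_assoc, add_add_add_comm]

theorem abs_sin_even_site {n : ℕ} (m : ℕ) (i : ℤ) :
    |Real.sin (Real.pi * (2 * m : ℕ) * (i + (n + 1 : ℕ)) / (2 * (n + 1 : ℕ)))| =
      |Real.sin (Real.pi * (i * ((m + 0) / (n + 1 : ℕ))))| := by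
  have hn : (n + 1 : ℝ) ≠ 0 := by positivity
  rw [show Real.pi * (2 * m : ℕ) * (i + (n + 1 : ℕ)) / (2 * (n + 1 : ℕ)) =
    Real.pi * (i * ((m + 0) / (n + 1 : ℕ))) + m * Real.pi by push_cast; field_simp; ring,
    Real.sin_add_nat_mul_pi, abs_mul, abs_neg_one_pow, one_mul]

theorem abs_sin_odd_site {n : ℕ} (m : ℕ) (i : ℤ) :
    |Real.sin (Real.pi * (2 * m + 1 : ℕ) * (i + (n + 1 : ℕ)) / (2 * (n + 1 : ℕ)))| =
      |Real.cos (Real.pi * (i * ((m + 1 / 2) / (n + 1 : ℕ))))| := by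
  have hn : (n + 1 : ℝ) ≠ 0 := by positivity
  rw [show Real.pi * (2 * m + 1 : ℕ) * (i + (n + 1 : ℕ)) / (2 * (n + 1 : ℕ)) =
    Real.pi * (i * ((m + 1 / 2) / (n + 1 : ℕ))) + Real.pi / 2 + m * Real.pi by
      push_cast; field_simp; ring,
    Real.sin_add_nat_mul_pi, abs_mul, abs_neg_one_pow, one_mul, Real.sin_add_pi_div_two]

theorem sqrt_pmaxCentered_eq {n : ℕ} {i j : ℤ} (hi : |i| ≤ n) (hj : |j| ≤ n) :
    √(pmaxCentered n i j) =
      1 / ((n + 1 : ℕ) : ℝ) * ∑ m ∈ Finset.range (n + 1),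
        |Real.sin (Real.pi * (i * ((m + 0) / (n + 1 : ℕ))))| *
          |Real.sin (Real.pi * (j * ((m + 0) / (n + 1 : ℕ))))| +
      1 / ((n + 1 : ℕ) : ℝ) * ∑ m ∈ Finset.range (n + 1),
        |Real.cos (Real.pi * (i * ((m + 1 / 2) / (n + 1 : ℕ))))| *
          |Real.cos (Real.pi * (j * ((m + 1 / 2) / (n + 1 : ℕ))))| := by
  have hcast : ∀ i : ℤ, |i| ≤ n → (((i + n).toNat : ℕ) : ℝ) + 1 = i + (n + 1 : ℕ) := by
    intro i hi
    have h : (((i + n).toNat : ℕ) : ℤ) = i + n := Int.toNat_of_nonneg (by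
      have := abs_le.mp hi; omega)
    have h' : (((i + n).toNat : ℕ) : ℝ) = i + n := by exact_mod_cast h
    rw [h']; push_cast; ring
  rw [pmaxCentered, dif_pos ⟨hi, hj⟩, sqrt_pmax_eq]
  simp only [hcast i hi, hcast j hj]
  have hN : ((2 * n + 1 : ℕ) : ℝ) + 1 = 2 * ((n + 1 : ℕ) : ℝ) := by push_cast; ring
  rw [hN, ← mul_add, div_mul_cancel_left₀ two_ne_zero, one_div]
  congr 1
  let g : ℕ → ℝ := fun k =>
    |Real.sin (Real.pi * k * (i + (n + 1 : ℕ)) / (2 * (n + 1 : ℕ)))| *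
      |Real.sin (Real.pi * k * (j + (n + 1 : ℕ)) / (2 * (n + 1 : ℕ)))|
  -- Including `k = 0` gives `2(n+1)` terms, which split evenly by parity.
  have h0 : g 0 = 0 := by simp [g]
  calc _ = ∑ l : Fin (2 * n + 1), g (l + 1) := by simp only [g]; push_cast; rfl
    _ = ∑ k ∈ Finset.range (2 * (n + 1)), g k := by
      rw [Fin.sum_univ_eq_sum_range (fun l => g (l + 1)), Nat.mul_succ,
        Finset.sum_range_succ' g, h0, add_zero]
    _ = _ := by
      rw [sum_range_two_mul]
      simp only [g, abs_sin_even_site, abs_sin_odd_site]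

theorem tendsto_sqrt_pmaxCentered (i j : ℤ) :
    Tendsto (fun n : ℕ => √(pmaxCentered n i j)) atTop (𝓝 (amplitudeIntegral i j)) := by
  have hs := (tendsto_riemannSum (f := fun x =>
    |Real.sin (Real.pi * (i * x))| * |Real.sin (Real.pi * (j * x))|) (by fun_prop) le_rfl
      zero_le_one).comp (tendsto_add_atTop_nat 1)
  have hc := (tendsto_riemannSum (f := fun x =>
    |Real.cos (Real.pi * (i * x))| * |Real.cos (Real.pi * (j * x))|) (by fun_prop)
      (s := 1 / 2) (by norm_num) (by norm_num)).comp (tendsto_add_atTop_nat 1)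
  have h := hs.add hc
  rw [← intervalIntegral.integral_add (Continuous.intervalIntegrable (by fun_prop) _ _)
    (Continuous.intervalIntegrable (by fun_prop) _ _)] at h
  refine h.congr' ?_
  -- Small `n`, where `pmaxCentered` takes its default `0`, are discarded.
  filter_upwards [eventually_ge_atTop i.natAbs, eventually_ge_atTop j.natAbs] with n hi hj
  rw [sqrt_pmaxCentered_eq (abs_le.mpr ⟨by omega, by omega⟩) (abs_le.mpr ⟨by omega, by omega⟩)]
  rfl

theorem amplitudeDoubly_eq (i j : ℤ) : amplitudeDoubly i j = amplitudeIntegral i j :=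
  (tendsto_sqrt_pmaxCentered i j).limUnder_eq

theorem two_div_pi_lt_eight_div_pi_sq : 2 / Real.pi < 8 / Real.pi ^ 2 := by
  have := Real.pi_pos
  rw [div_lt_div_iff₀ (by positivity) (by positivity)]
  nlinarith [Real.pi_lt_four]

theorem two_div_pi_le_amplitudeIntegral (i j : ℤ) : 2 / Real.pi ≤ amplitudeIntegral i j := by
  by_cases hi : i = 0
  · by_cases hj : j = 0
    · rw [hi, hj, amplitudeIntegral_zero_zero, div_le_one Real.pi_pos]
      exact Real.two_le_pi
    · rw [hi, amplitudeIntegral_zero_left hj]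
  · by_cases hj : j = 0
    · rw [hj, amplitudeIntegral_comm, amplitudeIntegral_zero_left hi]
    · exact two_div_pi_lt_eight_div_pi_sq.le.trans (amplitudeIntegral_ge hi hj)

/-! ### Distances and diameter. -/

/-- The lower bound `2/π` keeps the amplitude positive, so the value `+∞` never occurs. -/
theorem itcDistDoubly_eq (i j : ℤ) :
    itcDistDoubly i j = ((-2 * Real.log (amplitudeIntegral i j) : ℝ) : EReal) := by
  have hpos : 0 < amplitudeIntegral i j :=
    (div_pos two_pos Real.pi_pos).trans_le (two_div_pi_le_amplitudeIntegral i j)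
  rw [itcDistDoubly, pmaxDoubly, amplitudeDoubly_eq, ENNReal.log_ofReal_of_pos (by positivity),
    Real.log_pow, ← EReal.coe_neg]
  congr 1
  push_cast
  ring

theorem itcDistDoubly_zero_left {j : ℤ} (hj : j ≠ 0) :
    itcDistDoubly 0 j = ((-2 * Real.log (2 / Real.pi) : ℝ) : EReal) := by
  rw [itcDistDoubly_eq, amplitudeIntegral_zero_left hj]

theorem itcDistDoubly_comm (i j : ℤ) : itcDistDoubly i j = itcDistDoubly j i := by
  rw [itcDistDoubly_eq, itcDistDoubly_eq, amplitudeIntegral_comm]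

theorem itcDistDoubly_le (i j : ℤ) :
    itcDistDoubly i j ≤ ((-2 * Real.log (2 / Real.pi) : ℝ) : EReal) := by
  rw [itcDistDoubly_eq, EReal.coe_le_coe_iff]
  have := Real.log_le_log (div_pos two_pos Real.pi_pos) (two_div_pi_le_amplitudeIntegral i j)
  linarith

theorem mainTheorem7 :
    -- the limits defining the amplitudes of the doubly-infinite chain exist
    (∀ i j : ℤ, Tendsto (fun n : ℕ => √(pmaxCentered n i j)) atTop (𝓝 (amplitudeDoubly i j))) ∧
    -- the diameter is finite, with the stated value
    itcDiamDoubly = ((-2 * Real.log (2 / Real.pi) : ℝ) : EReal) ∧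
    -- it is attained by every pair consisting of the center and another spin
    (∀ j : ℤ, j ≠ 0 →
      itcDistDoubly 0 j = ((-2 * Real.log (2 / Real.pi) : ℝ) : EReal) ∧
      itcDistDoubly j 0 = ((-2 * Real.log (2 / Real.pi) : ℝ) : EReal)) ∧
    -- pairs of spins other than the center have a larger amplitude
    (∀ i j : ℤ, i ≠ 0 → j ≠ 0 → 8 / Real.pi ^ 2 ≤ amplitudeDoubly i j) ∧
    2 / Real.pi < 8 / Real.pi ^ 2 := by
  refine ⟨fun i j => ?_, ?_, fun j hj => ⟨itcDistDoubly_zero_left hj, ?_⟩, fun i j hi hj => ?_,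
    two_div_pi_lt_eight_div_pi_sq⟩
  · rw [amplitudeDoubly_eq]
    exact tendsto_sqrt_pmaxCentered i j
  · refine le_antisymm (iSup₂_le itcDistDoubly_le) ?_
    rw [← itcDistDoubly_zero_left one_ne_zero]
    exact le_iSup₂ (f := fun i j => itcDistDoubly i j) 0 1
  · rw [itcDistDoubly_comm, itcDistDoubly_zero_left hj]
  · rw [amplitudeDoubly_eq]
    exact amplitudeIntegral_ge hi hj
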